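/- Let $d\ge 1$ and let $P\subset[0,\infty)^d$ be a compact convex set with nonempty interior and $0\in P$. Let $f:P\to(0,\infty)$ be continuous and let $(c_{\alpha,n})$, $\alpha\in\mathbb Z_+^d$, $n\in\mathbb N$, be complex numbers such that $$\lim_{n\to\infty}\ \sup_{\alpha\in nP\cap\mathbb Z_+^d}\Big|\frac1n\log|c_{\alpha,n}|-\log f(\alpha/n)\Big|=0,\qquad \log 0:=-\infty,$$ where $nP=\{nt:t\in P\}$. Let $(\xi_\alpha)_{\alpha\in\mathbb Z_+^d}$ be i.i.d. complex-valued random variables on a probability space such that $\xi_0$ is not almost surely constant and $$\mathbb P\big(\log(1+|\xi_0|)>t\big)=o(t^{-d})\qquad (t\to\infty).$$ Put $$\mathbf P_n(z)=\sum_{\alpha\in nP\cap\mathbb Z_+^d}\xi_\alpha\,c_{\alpha,n}\,z^\alpha\quad(z\in\mathbb C^d),\qquad I_{P,f}(s)=\sup_{t\in P}\big(\langle s,t\rangle+\log f(t)\big)\quad(s\in\mathbb R^d),$$ where $\langle s,t\rangle=\sum_j s_jt_j$, and for $z\in(\mathbb C^*)^d$ put $\mathrm{Log}(z)=(\log|z_1|,\dots,\log|z_d|)$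 and $\Phi_{P,f}(z)=I_{P,f}(\mathrm{Log}(z))$. By convention, $\frac1n\log|\mathbf P_n|:=0$ on the event that $\mathbf P_n$ vanishes identically; elsewhere $\frac1n\log|\mathbf P_n(z)|\in[-\infty,\infty)$. Then for every $z\in(\mathbb C^*)^d$: 1. $\frac1n\log|\mathbf P_n(z)|\to\Phi_{P,f}(z)$ in probability as $n\to\infty$, that is, for every open neighbourhood $O$ of $\Phi_{P,f}(z)$ in $[-\infty,\infty]$, $\mathbb P\big(\frac1n\log|\mathbf P_n(z)|\in O\big)\to1$. 2. For every $\eta>0$ there is a constant $C'>0$, independent of $n$, such that for all $n\ge1$ $$\mathbb P\Big(|\mathbf P_n(z)|\le e^{n(I_{P,f}(\mathrm{Log}(z))-4\eta)}\Big)\le C'\,n^{-d/2}.$$ -/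

import Mathlib

open MeasureTheory ProbabilityTheory Filter Topology Asymptotics
open scoped ENNReal Pointwise

noncomputable section

namespace RandomPPolynomial

/-- The lattice set `nP ∩ ℤ₊^d`, where `nP = {n t : t ∈ P}`. -/
def latticeSet {d : ℕ} (P : Set (Fin d → ℝ)) (n : ℕ) : Set (Fin d → ℕ) :=
  {α | (fun j => (α j : ℝ)) ∈ (n : ℝ) • P}

/-- The logarithm of the modulus of a complex number, with `log 0 = -∞`. -/
def logAbs (w : ℂ) : EReal := ENNReal.log ‖w‖ₑ

/-- The asymptotic exponential profile condition
`sup_{α ∈ nP ∩ ℤ₊^d} |(1/n) log |c_{α,n}| - log f(α/n)| → 0` as `n → ∞`. The supremum is taken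
in `[0, ∞]`; it is `∞` as soon as one of the coefficients vanishes. -/
def HasExponentialProfile {d : ℕ} (P : Set (Fin d → ℝ)) (f : (Fin d → ℝ) → ℝ)
    (c : (Fin d → ℕ) → ℕ → ℂ) : Prop :=
  Tendsto
    (fun n : ℕ => ⨆ α ∈ latticeSet P n,
      (logAbs (c α n) / (n : EReal) -
        ((Real.log (f (fun j => (α j : ℝ) / (n : ℝ))) : ℝ) : EReal)).abs)
    atTop (𝓝 (0 : ℝ≥0∞))

/-- The random `P`-polynomial
`P_n(z, ω) = ∑_{α ∈ nP ∩ ℤ₊^d} ξ_α(ω) c_{α,n} z^α` (a finite sum when `P` is bounded). -/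
def randomPoly {d : ℕ} {Ω : Type*} (P : Set (Fin d → ℝ)) (ξ : (Fin d → ℕ) → Ω → ℂ)
    (c : (Fin d → ℕ) → ℕ → ℂ) (n : ℕ) (z : Fin d → ℂ) (ω : Ω) : ℂ :=
  ∑ᶠ α ∈ latticeSet P n, ξ α ω * c α n * ∏ j, z j ^ α j

open Classical in
/-- The normalized logarithmic potential `(1/n) log |P_n(z, ω)| ∈ [-∞, ∞)`, with the convention
that it is `0` when the polynomial `P_n(·, ω)` vanishes identically. -/
def logPotential {d : ℕ} {Ω : Type*} (P : Set (Fin d → ℝ)) (ξ : (Fin d → ℕ) → Ω → ℂ)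
    (c : (Fin d → ℕ) → ℕ → ℂ) (n : ℕ) (z : Fin d → ℂ) (ω : Ω) : EReal :=
  if ∀ w : Fin d → ℂ, randomPoly P ξ c n w ω = 0 then 0
  else logAbs (randomPoly P ξ c n z ω) / (n : EReal)

/-- The restricted Legendre–Fenchel transform
`I_{P,f}(s) = sup_{t ∈ P} (⟨s, t⟩ + log f(t))`. -/
def legendreTransform {d : ℕ} (P : Set (Fin d → ℝ)) (f : (Fin d → ℝ) → ℝ)
    (s : Fin d → ℝ) : ℝ :=
  sSup ((fun t : Fin d → ℝ => (∑ j, s j * t j) + Real.log (f t)) '' P)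

/-- The logarithmic map `Log z = (log |z_1|, …, log |z_d|)` on the complex torus. -/
def logMap {d : ℕ} (z : Fin d → ℂ) : Fin d → ℝ := fun j => Real.log ‖z j‖

/-- The potential `Φ_{P,f} = I_{P,f} ∘ Log` on the complex torus `(ℂ^*)^d`. -/
def torusPotential {d : ℕ} (P : Set (Fin d → ℝ)) (f : (Fin d → ℝ) → ℝ)
    (z : Fin d → ℂ) : ℝ :=
  legendreTransform P f (logMap z)

/-- Convergence in probability of random elements `X n` of a topological space to a deterministic
point `x`: every open neighbourhood `O` of `x` satisfies `μ(X n ∈ O) → 1`. -/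
def TendstoInProbability {Ω S : Type*} [MeasurableSpace Ω] [TopologicalSpace S]
    (μ : Measure Ω) (X : ℕ → Ω → S) (x : S) : Prop :=
  ∀ O : Set S, IsOpen O → x ∈ O → Tendsto (fun n => μ {ω | X n ω ∈ O}) atTop (𝓝 1)

end RandomPPolynomial

end

namespace RandomPPolynomial

/-! Both tails of `(1/n) log |P_n(z)|` are controlled separately. Let `I` be the maximum over `P` of
`⟨Log z, t⟩ + log f(t)`. The profile condition says that the weight `c_{α,n} z^α` has modulus `exp(n
(exponent at α/n))`, up to a factor `e^{±nε}`.

Upper tail (`tendsto_upper_deviation`): there are `O(n^d)` terms and the tail of `log(1+|ξ|)` is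
`o(t^{-d})`, so a union bound makes all `|ξ_α| ≤ e^{nε}` with probability tending to 1; the sum is
then at most `e^{n(I+3ε)}`.

Lower tail (`exists_lower_deviation_bound`): near a maximiser, continuity and convexity give at
least `κ n^d` lattice points whose weights exceed `e^{n(I-2η)}`. A Kolmogorov–Rogozin bound
(`exists_small_ball_bound`) then gives probability `O((n^d)^{-1/2})`. No moments are needed for it:
each variable is replaced by a pair of independent copies, one of which is selected by a uniformly
random subset. With the pairs frozen, only a random subset sum is left, to which Littlewood–Offord
applies through Sperner's theorem; Chebyshev ensures that enough pairs are well separated. -/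

/-! ### Littlewood–Offord counting -/

lemma centralBinom_sq_le (k : ℕ) : (2 * k + 1) * k.centralBinom ^ 2 ≤ 16 ^ k := by
  induction k with
  | zero => simp
  | succ k ih =>
    have h := Nat.succ_mul_centralBinom_succ k
    -- The factor `(k + 1) ^ 2` lets the recurrence for central binomials apply; what remains is
    -- `(2k+1)(2k+3) ≤ 4(k+1)²`.
    have h2 : (k + 1) ^ 2 * ((2 * (k + 1) + 1) * (k + 1).centralBinom ^ 2) ≤
        (k + 1) ^ 2 * 16 ^ (k + 1) := by
      calc (k + 1) ^ 2 * ((2 * (k + 1) + 1) * (k + 1).centralBinom ^ 2)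
          = (2 * k + 3) * ((k + 1) * (k + 1).centralBinom) ^ 2 := by ring
        _ = 4 * ((2 * k + 1) * (2 * k + 3)) * ((2 * k + 1) * k.centralBinom ^ 2) := by
            rw [h]; ring
        _ ≤ 4 * (4 * (k + 1) ^ 2) * 16 ^ k := by
            refine Nat.mul_le_mul (Nat.mul_le_mul_left 4 ?_) ih
            nlinarith
        _ = (k + 1) ^ 2 * 16 ^ (k + 1) := by ring
    exact Nat.le_of_mul_le_mul_left h2 (by positivity)

/-- The middle binomial coefficient is `O(2 ^ m / √m)`. -/
lemma succ_mul_choose_half_sq_le (m : ℕ) : (m + 1) * m.choose (m / 2) ^ 2 ≤ 2 * 4 ^ m := by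
  obtain ⟨k, rfl | rfl⟩ := Nat.even_or_odd' m
  · have h := centralBinom_sq_le k
    rw [Nat.centralBinom] at h
    rw [Nat.mul_div_cancel_left k (by norm_num), pow_mul]
    norm_num
    omega
  · have h := centralBinom_sq_le k
    have h1 : (2 * k + 1) / 2 = k := by omega
    have h2 : (2 * k + 1).choose k ≤ 2 * k.centralBinom := by
      cases k with
      | zero => simp
      | succ j =>
        rw [Nat.choose_succ_succ, two_mul (Nat.centralBinom _)]
        exact add_le_add (Nat.choose_le_centralBinom _ _) (Nat.choose_le_centralBinom _ _)
    rw [h1]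
    calc (2 * k + 1 + 1) * (2 * k + 1).choose k ^ 2
        ≤ (2 * (2 * k + 1)) * (2 * k.centralBinom) ^ 2 := by
          gcongr
          omega
      _ = 8 * ((2 * k + 1) * k.centralBinom ^ 2) := by ring
      _ ≤ 8 * 16 ^ k := by gcongr
      _ = 2 * 4 ^ (2 * k + 1) := by rw [pow_succ, pow_mul]; norm_num; ring

/-- The Littlewood–Offord–Erdős inequality: among all subset sums of real numbers, at most the
indicated number falls in a short interval. -/
lemma card_subset_sum_le {ι : Type*} [Fintype ι] [DecidableEq ι] (v : ι → ℝ) (G : Finset ι)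
    {ρ r : ℝ} (hv : ∀ i ∈ G, ρ ≤ v i) (hρ : 0 < ρ) (hr : 2 * r < ρ) (w : ℝ) :
    (Finset.univ.filter fun S : Finset ι => |w + ∑ i ∈ S, v i| ≤ r).card ≤
      G.card.choose (G.card / 2) * 2 ^ (Fintype.card ι - G.card) := by
  classical
  set 𝒜 := Finset.univ.filter fun S : Finset ι => |w + ∑ i ∈ S, v i| ≤ r with h𝒜
  -- Sets are grouped by their part outside `G`; in each group the traces on `G` will form an
  -- antichain.
  have himg : (𝒜.image fun S => S \ G).card ≤ 2 ^ (Fintype.card ι - G.card) := by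
    rw [← Finset.card_compl, ← Finset.card_powerset]
    refine Finset.card_le_card fun T hT => ?_
    obtain ⟨S, -, rfl⟩ := Finset.mem_image.1 hT
    rw [Finset.mem_powerset]
    intro i hi
    simp only [Finset.mem_sdiff] at hi
    simpa using hi.2
  refine (Finset.card_le_mul_card_image 𝒜 (G.card.choose (G.card / 2)) (f := fun S => S \ G)
    fun T hT => ?_).trans (Nat.mul_le_mul_left _ himg)
  set ℱ := 𝒜.filter fun S => S \ G = T with hℱ
  -- within a fibre the traces on `G` determine the inclusion order
  have hsub : ∀ S ∈ ℱ, ∀ S' ∈ ℱ,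
      S.subtype (· ∈ G) ⊆ S'.subtype (· ∈ G) → S ⊆ S' := by
    intro S hS S' hS' h i hi
    by_cases hiG : i ∈ G
    · have : (⟨i, hiG⟩ : {x // x ∈ G}) ∈ S.subtype (· ∈ G) := by simpa using hi
      simpa using h this
    · have h1 : i ∈ S \ G := by simp [hi, hiG]
      rw [(Finset.mem_filter.1 hS).2, ← (Finset.mem_filter.1 hS').2] at h1
      exact (Finset.mem_sdiff.1 h1).1
  -- Strictly nested sets in one fibre differ only in `G`, so their sums differ by at least `ρ > 2r`
  -- and cannot both lie in the interval.
  have hanti : ∀ S ∈ ℱ, ∀ S' ∈ ℱ, S ⊆ S' → S = S' := by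
    intro S hS S' hS' h
    by_contra hne
    obtain ⟨i, hi', hi⟩ := Finset.exists_of_ssubset (h.ssubset_of_ne hne)
    have hG : ∀ j ∈ S' \ S, j ∈ G := by
      intro j hj
      by_contra hjG
      rw [Finset.mem_sdiff] at hj
      have h1 : j ∈ S' \ G := by simp [hj.1, hjG]
      rw [(Finset.mem_filter.1 hS').2, ← (Finset.mem_filter.1 hS).2] at h1
      exact hj.2 (Finset.mem_sdiff.1 h1).1
    have h1 : ρ ≤ ∑ j ∈ S' \ S, v j :=
      (hv i (hG i (by simp [hi, hi']))).trans
        (Finset.single_le_sum (f := v) (fun j hj => hρ.le.trans (hv j (hG j hj)))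
          (by simp [hi, hi']))
    have h2 := Finset.sum_sdiff (f := v) h
    have h3 : |w + ∑ i ∈ S, v i| ≤ r :=
      (Finset.mem_filter.1 (Finset.mem_filter.1 hS).1).2
    have h4 : |w + ∑ i ∈ S', v i| ≤ r :=
      (Finset.mem_filter.1 (Finset.mem_filter.1 hS').1).2
    rw [abs_le] at h3 h4
    linarith [h3.1, h4.2]
  have hinj : Set.InjOn (fun S : Finset ι => S.subtype (· ∈ G)) ℱ := fun S hS S' hS' h =>
    hanti S hS S' hS' (hsub S hS S' hS' (le_of_eq h))
  rw [← Finset.card_image_of_injOn hinj]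
  have hA : IsAntichain (· ⊆ ·)
      (SetLike.coe (ℱ.image fun S : Finset ι => S.subtype (· ∈ G))) := by
    intro U hU U' hU' hne hUU'
    rw [Finset.mem_coe, Finset.mem_image] at hU hU'
    obtain ⟨S, hS, rfl⟩ := hU
    obtain ⟨S', hS', rfl⟩ := hU'
    exact hne (by rw [hanti S hS S' hS' (hsub S hS S' hS' hUU')])
  simpa using hA.sperner

/-- With the middle binomial estimated, the proportion of subsets is `O(|G|^{-1/2})`, the form that
passes to probabilities. -/
lemma card_subset_sum_le_real {ι : Type*} [Fintype ι] [DecidableEq ι] (v : ι → ℝ) (G : Finset ι)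
    {ρ r : ℝ} (hv : ∀ i ∈ G, ρ ≤ v i) (hρ : 0 < ρ) (hr : 2 * r < ρ) (w : ℝ) :
    ((Finset.univ.filter fun S : Finset ι => |w + ∑ i ∈ S, v i| ≤ r).card : ℝ) *
      √(G.card + 1) ≤ √2 * 2 ^ Fintype.card ι := by
  have h1 : ((Finset.univ.filter fun S : Finset ι => |w + ∑ i ∈ S, v i| ≤ r).card : ℝ) ≤
      (G.card.choose (G.card / 2) : ℝ) * 2 ^ (Fintype.card ι - G.card) := by
    exact_mod_cast card_subset_sum_le v G hv hρ hr w
  have h2 : ((G.card : ℝ) + 1) * (G.card.choose (G.card / 2) : ℝ) ^ 2 ≤ 2 * 4 ^ G.card := by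
    exact_mod_cast succ_mul_choose_half_sq_le G.card
  have h3 : (G.card.choose (G.card / 2) : ℝ) * √(G.card + 1) ≤ √2 * 2 ^ G.card := by
    refine le_of_sq_le_sq ?_ (by positivity)
    rw [mul_pow, mul_pow, Real.sq_sqrt (by positivity), Real.sq_sqrt (by positivity), ← pow_mul,
      mul_comm G.card 2, pow_mul]
    norm_num
    linarith
  calc _ ≤ ((G.card.choose (G.card / 2) : ℝ) * 2 ^ (Fintype.card ι - G.card)) *
        √(G.card + 1) := by gcongr
    _ = ((G.card.choose (G.card / 2) : ℝ) * √(G.card + 1)) * 2 ^ (Fintype.card ι - G.card) := by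
        ring
    _ ≤ (√2 * 2 ^ G.card) * 2 ^ (Fintype.card ι - G.card) := by gcongr
    _ = √2 * 2 ^ Fintype.card ι := by
        rw [mul_assoc, ← pow_add, Nat.add_sub_cancel' (Finset.card_le_univ G)]

/-- A Littlewood–Offord inequality for subset sums of complex numbers. -/
lemma card_subset_sum_le_complex {ι : Type*} [Fintype ι] [DecidableEq ι] (v : ι → ℂ)
    (G : Finset ι) {ρ r : ℝ} (hv : ∀ i ∈ G, ρ ≤ ‖v i‖) (hρ : 0 < ρ) (hr : 4 * r < ρ) (w : ℂ) :
    ((Finset.univ.filter fun S : Finset ι => ‖w + ∑ i ∈ S, v i‖ ≤ r).card : ℝ) *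
      √(G.card + 1) ≤ 3 * 2 ^ Fintype.card ι := by
  -- a real linear functional bounded by the norm which is large on a quarter of the indices
  have key : ∀ φ : ℂ →ₗ[ℝ] ℝ, (∀ x, |φ x| ≤ ‖x‖) →
      G.card ≤ 4 * (G.filter fun i => ρ / 2 ≤ φ (v i)).card →
      ((Finset.univ.filter fun S : Finset ι => ‖w + ∑ i ∈ S, v i‖ ≤ r).card : ℝ) *
        √(G.card + 1) ≤ 3 * 2 ^ Fintype.card ι := by
    intro φ hφ hG
    set G' := G.filter fun i => ρ / 2 ≤ φ (v i)
    have h1 := card_subset_sum_le_real (fun i => φ (v i)) G' (ρ := ρ / 2) (r := r)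
      (fun i hi => (Finset.mem_filter.1 hi).2) (by linarith) (by linarith) (φ w)
    have h2 : √((G.card : ℝ) + 1) ≤ 2 * √((G'.card : ℝ) + 1) := by
      rw [show (2 : ℝ) = √4 by rw [show (4 : ℝ) = 2 ^ 2 by norm_num]; simp,
        ← Real.sqrt_mul (by norm_num)]
      apply Real.sqrt_le_sqrt
      have : (G.card : ℝ) ≤ 4 * G'.card := by exact_mod_cast hG
      linarith
    have h3 : ((Finset.univ.filter fun S : Finset ι => ‖w + ∑ i ∈ S, v i‖ ≤ r).card : ℝ) ≤
        ((Finset.univ.filter fun S : Finset ι => |φ w + ∑ i ∈ S, φ (v i)| ≤ r).card : ℝ) := by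
      norm_cast
      refine Finset.card_le_card fun S hS => ?_
      simp only [Finset.mem_filter, Finset.mem_univ, true_and] at hS ⊢
      rw [← map_sum, ← map_add]
      exact (hφ _).trans hS
    have h4 : √2 ≤ (3 / 2 : ℝ) := by
      rw [Real.sqrt_le_left (by norm_num)]; norm_num
    calc _ ≤ ((Finset.univ.filter fun S : Finset ι => |φ w + ∑ i ∈ S, φ (v i)| ≤ r).card : ℝ) *
          (2 * √((G'.card : ℝ) + 1)) := by gcongr
      _ ≤ 2 * (√2 * 2 ^ Fintype.card ι) := by linarith
      _ ≤ 2 * (3 / 2 * 2 ^ Fintype.card ι) := by gcongr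
      _ = _ := by ring
  -- Since `ρ ≤ |Re| + |Im|`, one of `±Re`, `±Im` is at least `ρ / 2`; by pigeonhole one of these
  -- four functionals serves a quarter of `G`.
  have hcover : G ⊆ ((G.filter fun i => ρ / 2 ≤ Complex.reLm (v i)) ∪
      (G.filter fun i => ρ / 2 ≤ (-Complex.reLm) (v i))) ∪
      ((G.filter fun i => ρ / 2 ≤ Complex.imLm (v i)) ∪
      (G.filter fun i => ρ / 2 ≤ (-Complex.imLm) (v i))) := by
    intro i hi
    have h1 := (hv i hi).trans (Complex.norm_le_abs_re_add_abs_im (v i))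
    simp only [Finset.mem_union, Finset.mem_filter, hi, true_and]
    simp only [LinearMap.neg_apply, Complex.reLm_coe, Complex.imLm_coe]
    rcases abs_cases (v i).re with h | h <;> rcases abs_cases (v i).im with h' | h' <;>
      by_contra! hcon <;> linarith [hcon.1.1, hcon.1.2, hcon.2.1, hcon.2.2]
  have hcard := (Finset.card_le_card hcover).trans ((Finset.card_union_le _ _).trans
    (add_le_add (Finset.card_union_le _ _) (Finset.card_union_le _ _)))
  by_cases ha : G.card ≤ 4 * (G.filter fun i => ρ / 2 ≤ Complex.reLm (v i)).card
  · exact key _ (fun x => Complex.abs_re_le_norm x) ha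
  by_cases hb : G.card ≤ 4 * (G.filter fun i => ρ / 2 ≤ (-Complex.reLm) (v i)).card
  · exact key _ (fun x => by simpa using Complex.abs_re_le_norm x) hb
  by_cases hc : G.card ≤ 4 * (G.filter fun i => ρ / 2 ≤ Complex.imLm (v i)).card
  · exact key _ (fun x => Complex.abs_im_le_norm x) hc
  · exact key (-Complex.imLm) (fun x => by simpa using Complex.abs_im_le_norm x) (by omega)

/-! ### Small ball probabilities -/

/-- Two independent copies of a nondegenerate random variable are separated with positive
probability. -/
lemma exists_separation {ν : Measure ℂ} [IsProbabilityMeasure ν]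
    (hν : ¬ ∃ a : ℂ, ∀ᵐ x ∂ν, x = a) :
    ∃ ρ : ℝ, 0 < ρ ∧ 0 < (ν.prod ν).real {p | ρ ≤ ‖p.1 - p.2‖} := by
  by_contra! h
  apply hν
  have h0 : ∀ k : ℕ, (ν.prod ν) {p | 1 / ((k : ℝ) + 1) ≤ ‖p.1 - p.2‖} = 0 := fun k => by
    have := le_antisymm (h (1 / ((k : ℝ) + 1)) (by positivity)) measureReal_nonneg
    rwa [measureReal_eq_zero_iff] at this
  have h1 : (ν.prod ν) {p | p.1 ≠ p.2} = 0 := by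
    refine measure_mono_null (fun p hp => ?_) (measure_iUnion_null h0)
    obtain ⟨k, hk⟩ := exists_nat_one_div_lt (norm_pos_iff.2 (sub_ne_zero.2 hp))
    exact Set.mem_iUnion.2 ⟨k, hk.le⟩
  -- Fubini: if two independent copies agree almost surely, some slice shows that the law is
  -- concentrated at one point `a`.
  obtain ⟨a, ha⟩ := (Measure.measure_ae_null_of_prod_null h1).exists
  refine ⟨a, ?_⟩
  rw [ae_iff]
  refine measure_mono_null (fun x hx => ?_) ha
  exact fun hax => hx hax.symm

/-- Chebyshev's inequality for the number of successes in independent Bernoulli trials. -/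
lemma pi_card_le_half {X ι : Type*} [Fintype ι] [MeasurableSpace X]
    (ν : Measure X) [IsProbabilityMeasure ν] {D : Set X} (hD : MeasurableSet D)
    [DecidablePred (· ∈ D)] (G : Finset ι) (hG : G.Nonempty) (hq : 0 < ν.real D) :
    (Measure.pi fun _ : ι => ν).real
      {y | ((G.filter fun i => y i ∈ D).card : ℝ) ≤ G.card * ν.real D / 2} ≤
      4 / (G.card * ν.real D) := by
  set q := ν.real D
  set N : ℝ := (G.card : ℝ)
  have hN : 0 < N := by
    exact Nat.cast_pos.2 hG.card_pos
  set π := Measure.pi fun _ : ι => ν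
  set g : X → ℝ := D.indicator 1 with hg
  have hgm : Measurable g := measurable_one.indicator hD
  have hmp : ∀ i : ι, MeasurePreserving (fun y : ι → X => y i) π ν := fun i =>
    measurePreserving_eval (fun _ : ι => ν) i
  have hgi : MemLp g 2 ν := MemLp.indicator hD (memLp_const 1)
  have hmem : ∀ i : ι, MemLp (fun y : ι → X => g (y i)) 2 π := fun i =>
    hgi.comp_measurePreserving (hmp i)
  have hint : ∀ i : ι, ∫ y, g (y i) ∂π = q := fun i => by
    rw [← integral_map (f := g) (hmp i).measurable.aemeasurable hgm.aestronglyMeasurable,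
      (hmp i).map_eq, hg, integral_indicator_one hD]
  have hvar : ∀ i : ι, Var[fun y : ι → X => g (y i); π] ≤ q := fun i => by
    refine (variance_le_expectation_sq (hmem i).aestronglyMeasurable).trans (le_of_eq ?_)
    rw [← hint i]
    congr 1
    ext y
    by_cases h : y i ∈ D <;> simp [hg, h]
  set Y : (ι → X) → ℝ := ∑ i ∈ G, fun y => g (y i) with hY
  have hYv : Var[Y; π] ≤ N * q := by
    rw [hY, IndepFun.variance_sum (fun i _ => hmem i)]
    · refine (Finset.sum_le_sum fun i _ => hvar i).trans ?_
      simp [N]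
    · intro i _ j _ hij
      exact (iIndepFun_pi (μ := fun _ : ι => ν) (X := fun _ => g)
        fun _ => hgm.aemeasurable).indepFun hij
  have hYi : ∫ y, Y y ∂π = N * q := by
    simp only [hY, Finset.sum_apply]
    rw [integral_finsetSum _ fun i _ => (hmem i).integrable (by norm_num)]
    simp [hint, N]
  have hYmem : MemLp Y 2 π := memLp_finsetSum' _ fun i _ => hmem i
  -- The mean is `N * q` and the variance at most `N * q`, so a deviation by half the mean costs `4
  -- / (N * q)`.
  have hcheb := meas_ge_le_variance_div_sq hYmem (c := N * q / 2) (by positivity)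
  have hYcard : ∀ y, Y y = ((G.filter fun i => y i ∈ D).card : ℝ) := fun y => by
    simp [hY, hg, Set.indicator_apply]
  calc π.real {y | ((G.filter fun i => y i ∈ D).card : ℝ) ≤ N * q / 2}
      ≤ π.real {y | N * q / 2 ≤ |Y y - ∫ x, Y x ∂π|} := by
        refine measureReal_mono fun y hy => ?_
        simp only [Set.mem_ofPred_eq] at hy ⊢
        rw [← hYcard] at hy
        rw [hYi, abs_sub_comm]
        exact le_trans (by linarith) (le_abs_self _)
    _ ≤ Var[Y; π] / (N * q / 2) ^ 2 :=
        ENNReal.toReal_le_of_le_ofReal (div_nonneg (variance_nonneg _ _) (by positivity)) hcheb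
    _ ≤ (N * q) / (N * q / 2) ^ 2 := by gcongr
    _ = 4 / (N * q) := by field_simp; norm_num

/-- A Kolmogorov–Rogozin type small ball estimate for weighted sums of i.i.d. complex random
variables, many weights of which have modulus at least one. -/
lemma pi_small_ball {ι : Type*} [Fintype ι] (ν : Measure ℂ) [IsProbabilityMeasure ν]
    {ρ r q : ℝ} (hρ : 0 < ρ) (hr : 4 * r < ρ) (hq : (ν.prod ν).real {p | ρ ≤ ‖p.1 - p.2‖} = q)
    (hq0 : 0 < q) (b : ι → ℂ) (G : Finset ι) (hG : G.Nonempty) (hb : ∀ i ∈ G, 1 ≤ ‖b i‖) :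
    (Measure.pi fun _ : ι => ν).real {x | ‖∑ i, x i * b i‖ ≤ r} ≤
      4 / (G.card * q) + 3 / √(G.card * q / 2) := by
  classical
  set D : Set (ℂ × ℂ) := {p | ρ ≤ ‖p.1 - p.2‖} with hD
  have hDm : MeasurableSet D := measurableSet_le (by fun_prop) (by fun_prop)
  set A : Set (ι → ℂ) := {x | ‖∑ i, x i * b i‖ ≤ r} with hA
  have hAm : MeasurableSet A := measurableSet_le (by fun_prop) (by fun_prop)
  set N : ℝ := (G.card : ℝ) with hN
  have hN0 : 0 < N := by
    exact Nat.cast_pos.2 hG.card_pos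
  set π := Measure.pi fun _ : ι => ν.prod ν with hπ
  set T : Finset ι → (ι → ℂ × ℂ) → ι → ℂ := fun S y i => if i ∈ S then (y i).2 else (y i).1
    with hT
  -- Whichever copies `S` selects, the law is the original product; hence the probability of `A`
  -- equals its average over all `S`.
  have hTmp : ∀ S, MeasurePreserving (T S) π (Measure.pi fun _ : ι => ν) := fun S => by
    refine measurePreserving_pi (fun _ => ν.prod ν) (fun _ => ν)
      (f := fun i p => if i ∈ S then p.2 else p.1) fun i => ?_
    by_cases h : i ∈ S
    · simpa [h] using measurePreserving_snd
    · simpa [h] using measurePreserving_fst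
  set B : Set (ι → ℂ × ℂ) :=
    {y | ((G.filter fun i => y i ∈ D).card : ℝ) ≤ N * q / 2} with hB
  have hBm : MeasurableSet B := by
    have : ∀ y : ι → ℂ × ℂ, ((G.filter fun i => y i ∈ D).card : ℝ) =
        ∑ i ∈ G, D.indicator 1 (y i) := fun y => by
      simp [Set.indicator_apply]
    simp only [hB, this]
    refine measurableSet_le (Finset.measurable_sum _ fun i _ => ?_) measurable_const
    exact (measurable_one.indicator hDm).comp (measurable_pi_apply i)
  have hBle : π.real B ≤ 4 / (N * q) := by
    have := pi_card_le_half (ν.prod ν) hDm G hG (by rw [hq]; exact hq0)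
    rwa [hq] at this
  -- On `B`, where few pairs are separated, all subsets are counted trivially; off `B`
  -- Littlewood–Offord applies to the increments `((y i).2 - (y i).1) * b i`.
  have hpoint : ∀ y, ∑ S : Finset ι, (T S ⁻¹' A).indicator (1 : (ι → ℂ × ℂ) → ℝ) y ≤
      2 ^ Fintype.card ι * (B.indicator 1 y + 3 / √(N * q / 2)) := fun y => by
    have hcard : ∑ S : Finset ι, (T S ⁻¹' A).indicator (1 : (ι → ℂ × ℂ) → ℝ) y =
        ((Finset.univ.filter fun S : Finset ι => T S y ∈ A).card : ℝ) := by
      simp [Set.indicator_apply]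
    rw [hcard]
    by_cases hy : y ∈ B
    · have h1 : ((Finset.univ.filter fun S : Finset ι => T S y ∈ A).card : ℝ) ≤
          2 ^ Fintype.card ι := by
        have := Finset.card_le_univ (Finset.univ.filter fun S : Finset ι => T S y ∈ A)
        rw [Fintype.card_finset] at this
        exact_mod_cast this
      refine h1.trans (le_mul_of_one_le_right (by positivity) ?_)
      rw [Set.indicator_of_mem hy]
      have : 0 ≤ 3 / √(N * q / 2) := by positivity
      simpa using this
    · have hsum : ∀ S, T S y ∈ A ↔
          ‖∑ i, (y i).1 * b i + ∑ i ∈ S, ((y i).2 - (y i).1) * b i‖ ≤ r := fun S => by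
        have h2 : ∑ i, T S y i * b i =
            ∑ i, (y i).1 * b i + ∑ i ∈ S, ((y i).2 - (y i).1) * b i := by
          rw [← Finset.univ_inter S, ← Finset.sum_ite_mem, ← Finset.sum_add_distrib]
          refine Finset.sum_congr rfl fun i _ => ?_
          by_cases h : i ∈ S
          · simp [hT, h]
            ring
          · simp [hT, h]
        rw [← h2]
        rfl
      simp only [hsum]
      have h1 := card_subset_sum_le_complex (fun i => ((y i).2 - (y i).1) * b i)
        (G.filter fun i => y i ∈ D) (ρ := ρ) (r := r) (fun i hi => by
          obtain ⟨hi1, hi2⟩ := Finset.mem_filter.1 hi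
          rw [norm_mul, norm_sub_rev]
          have : ρ ≤ ‖(y i).1 - (y i).2‖ := hi2
          nlinarith [hb i hi1]) hρ hr (∑ i, (y i).1 * b i)
      rw [Set.indicator_of_notMem hy, zero_add, mul_div_assoc', le_div_iff₀ (by positivity),
        mul_comm (2 ^ _ : ℝ) 3]
      refine le_trans ?_ h1
      gcongr
      simp only [hB, Set.mem_ofPred_eq, not_le] at hy
      linarith
  have hAint : ∀ S, ∫ y, (T S ⁻¹' A).indicator (1 : (ι → ℂ × ℂ) → ℝ) y ∂π =
      (Measure.pi fun _ : ι => ν).real A := fun S => by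
    rw [integral_indicator_one ((hTmp S).measurable hAm), measureReal_def, measureReal_def,
      (hTmp S).measure_preimage hAm.nullMeasurableSet]
  have hAi : ∀ S ∈ Finset.univ, Integrable ((T S ⁻¹' A).indicator (1 : (ι → ℂ × ℂ) → ℝ)) π := fun S _ =>
    (integrable_const (1 : ℝ)).indicator ((hTmp S).measurable hAm)
  have hBi : Integrable (B.indicator (1 : (ι → ℂ × ℂ) → ℝ)) π := (integrable_const (1 : ℝ)).indicator hBm
  have hmain : (2 : ℝ) ^ Fintype.card ι * (Measure.pi fun _ : ι => ν).real A ≤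
      2 ^ Fintype.card ι * (π.real B + 3 / √(N * q / 2)) := by
    calc (2 : ℝ) ^ Fintype.card ι * (Measure.pi fun _ : ι => ν).real A
        = ∫ y, ∑ S : Finset ι, (T S ⁻¹' A).indicator (1 : (ι → ℂ × ℂ) → ℝ) y ∂π := by
          rw [integral_finsetSum _ hAi]
          simp [hAint]
      _ ≤ ∫ y, 2 ^ Fintype.card ι * (B.indicator 1 y + 3 / √(N * q / 2)) ∂π :=
          integral_mono (integrable_finsetSum _ hAi)
            ((hBi.add (integrable_const _)).const_mul _) hpoint
      _ = 2 ^ Fintype.card ι * (π.real B + 3 / √(N * q / 2)) := by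
          rw [integral_const_mul, integral_add hBi (integrable_const _),
            integral_indicator_one hBm]
          simp
  have := le_of_mul_le_mul_left hmain (by positivity)
  linarith

/-- The Kolmogorov–Rogozin inequality at a fixed small scale for i.i.d. nondegenerate complex
random variables with weights. -/
lemma exists_small_ball_bound {Ω I : Type*} [MeasurableSpace Ω] {μ : Measure Ω}
    [IsProbabilityMeasure μ] {ξ : I → Ω → ℂ} (i₀ : I) (hmeas : ∀ i, Measurable (ξ i))
    (hindep : iIndepFun ξ μ) (hident : ∀ i, IdentDistrib (ξ i) (ξ i₀) μ μ)
    (hnondeg : ¬ ∃ a : ℂ, ∀ᵐ ω ∂μ, ξ i₀ ω = a) :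
    ∃ r : ℝ, 0 < r ∧ ∃ C : ℝ, 0 < C ∧ ∀ (A G : Finset I) (b : I → ℂ), G ⊆ A → G.Nonempty →
      (∀ i ∈ G, 1 ≤ ‖b i‖) →
      μ.real {ω | ‖∑ i ∈ A, ξ i ω * b i‖ ≤ r} ≤ C / √(G.card : ℝ) := by
  classical
  set ν := μ.map (ξ i₀) with hν
  have : IsProbabilityMeasure ν := Measure.isProbabilityMeasure_map (hmeas i₀).aemeasurable
  have hνdeg : ¬ ∃ a : ℂ, ∀ᵐ x ∂ν, x = a := by
    rintro ⟨a, ha⟩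
    exact hnondeg ⟨a, ae_of_ae_map (hmeas i₀).aemeasurable ha⟩
  obtain ⟨ρ, hρ, hq⟩ := exists_separation hνdeg
  set q := (ν.prod ν).real {p | ρ ≤ ‖p.1 - p.2‖} with hqdef
  -- Any radius below `ρ / 4` would do. The Chebyshev term `4 / (N q)` is absorbed using `√N ≤ N`.
  refine ⟨ρ / 5, by positivity, 4 / q + 3 / √(q / 2), by positivity, ?_⟩
  intro A G b hGA hG hb
  have hN : (1 : ℝ) ≤ G.card := Nat.one_le_cast.2 hG.card_pos
  have hlaw : μ.map (fun ω (i : A) => ξ i ω) = Measure.pi fun _ : A => ν := by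
    rw [(iIndepFun_iff_map_fun_eq_pi_map fun i : A => (hmeas i).aemeasurable).1
      (hindep.precomp (g := fun i : A => (i : I)) Subtype.val_injective)]
    congr 1
    ext1 i
    exact (hident i).map_eq
  have hcard : (G.subtype (· ∈ A)).card = G.card := by
    rw [Finset.card_subtype, Finset.filter_true_of_mem fun i hi => hGA hi]
  have h := pi_small_ball ν hρ (r := ρ / 5) (by linarith) hqdef.symm hq (fun i : A => b i)
    (G.subtype (· ∈ A)) (by rw [← Finset.card_pos, hcard]; exact hG.card_pos)
    (fun i hi => hb i (by simpa using hi))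
  rw [hcard, ← hlaw, map_measureReal_apply (measurable_pi_lambda _ fun i : A => hmeas i)
    (measurableSet_le (by fun_prop) (by fun_prop))] at h
  have hset : (fun ω (i : A) => ξ i ω) ⁻¹' {x | ‖∑ i, x i * b i‖ ≤ ρ / 5} =
      {ω | ‖∑ i ∈ A, ξ i ω * b i‖ ≤ ρ / 5} := by
    ext ω
    simp only [Set.mem_preimage, Set.mem_ofPred_eq]
    rw [← Finset.sum_coe_sort A fun i => ξ i ω * b i]
  rw [hset] at h
  refine h.trans ?_
  rw [add_div]
  have hs : √(G.card : ℝ) ≤ G.card := by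
    rw [Real.sqrt_le_left (by positivity)]
    nlinarith
  have hs0 : 0 < √(G.card : ℝ) := by positivity
  refine add_le_add ?_ (le_of_eq ?_)
  · rw [mul_comm, ← div_div]
    gcongr
  · rw [mul_div_assoc, Real.sqrt_mul (by positivity), mul_comm, div_div]

/-! ### Lattice points and the size of the monomials -/

/-- The exponent `⟨s, t⟩ + log f(t)` maximised by the Legendre–Fenchel transform. -/
noncomputable def exponent {d : ℕ} (f : (Fin d → ℝ) → ℝ) (s t : Fin d → ℝ) : ℝ :=
  (∑ j, s j * t j) + Real.log (f t)

lemma continuousOn_exponent {d : ℕ} {P : Set (Fin d → ℝ)} {f : (Fin d → ℝ) → ℝ}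
    (hf : ContinuousOn f P) (hpos : ∀ t ∈ P, 0 < f t) (s : Fin d → ℝ) :
    ContinuousOn (exponent f s) P :=
  ContinuousOn.add (by fun_prop) (hf.log fun t ht => (hpos t ht).ne')

lemma exists_isGreatest_exponent {d : ℕ} {P : Set (Fin d → ℝ)} {f : (Fin d → ℝ) → ℝ}
    (hP : IsCompact P) (hne : P.Nonempty)
    (hf : ContinuousOn f P) (hpos : ∀ t ∈ P, 0 < f t) (s : Fin d → ℝ) :
    ∃ t₀ ∈ P, legendreTransform P f s = exponent f s t₀ ∧
      ∀ t ∈ P, exponent f s t ≤ exponent f s t₀ := by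
  obtain ⟨t₀, ht₀, hmax⟩ := hP.exists_isMaxOn hne (continuousOn_exponent hf hpos s)
  refine ⟨t₀, ht₀, ?_, fun t ht => hmax ht⟩
  refine IsGreatest.csSup_eq (a := exponent f s t₀) ⟨⟨t₀, ht₀, rfl⟩, ?_⟩
  rintro _ ⟨t, ht, rfl⟩
  exact hmax ht

lemma logAbs_of_ne_zero {w : ℂ} (hw : w ≠ 0) : logAbs w = ((Real.log ‖w‖ : ℝ) : EReal) := by
  rw [logAbs, ← ofReal_norm, ENNReal.log_ofReal, if_neg (by simpa using hw)]

lemma mem_latticeSet_iff {d : ℕ} {P : Set (Fin d → ℝ)} {n : ℕ} (hn : n ≠ 0) {α : Fin d → ℕ} :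
    α ∈ latticeSet P n ↔ (fun j => (α j : ℝ) / n) ∈ P := by
  have hn' : (n : ℝ) ≠ 0 := Nat.cast_ne_zero.2 hn
  rw [latticeSet, Set.mem_ofPred_eq, Set.mem_smul_set_iff_inv_smul_mem₀ hn']
  have : (n : ℝ)⁻¹ • (fun j => (α j : ℝ)) = fun j => (α j : ℝ) / n := by
    ext j
    simp [div_eq_inv_mul]
  rw [this]

lemma exists_card_latticeSet_le {d : ℕ} {P : Set (Fin d → ℝ)} (hP : IsCompact P) :
    ∃ K : ℕ, ∀ n : ℕ, 1 ≤ n → ∃ h : (latticeSet P n).Finite,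
      h.toFinset.card ≤ (K * n) ^ d := by
  obtain ⟨R, hR⟩ := hP.isBounded.exists_norm_le
  obtain ⟨k, hk⟩ := exists_nat_ge R
  refine ⟨k + 1, fun n hn => ?_⟩
  have hn0 : (0 : ℝ) < n := Nat.cast_pos.2 hn
  have hsub : latticeSet P n ⊆
      (Fintype.piFinset fun _ : Fin d => Finset.range ((k + 1) * n) : Finset (Fin d → ℕ)) := by
    intro α hα
    rw [mem_latticeSet_iff (by omega)] at hα
    rw [Finset.mem_coe, Fintype.mem_piFinset]
    intro j
    have h1 := (norm_le_pi_norm _ j).trans (hR _ hα)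
    rw [Real.norm_of_nonneg (by positivity), div_le_iff₀ hn0] at h1
    have h2 : (α j : ℝ) ≤ k * n := h1.trans (by gcongr)
    have h3 : α j ≤ k * n := by exact_mod_cast h2
    rw [Finset.mem_range]
    nlinarith
  refine ⟨(Finset.finite_toSet _).subset hsub, ?_⟩
  have : (((Finset.finite_toSet _).subset hsub).toFinset) ⊆
      Fintype.piFinset fun _ : Fin d => Finset.range ((k + 1) * n) := by
    intro α hα
    exact hsub (by simpa using hα)
  simpa using Finset.card_le_card this

/-- A convex body has `≫ n ^ d` points of the lattice `n⁻¹ ℤ₊^d` near each of its points. -/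
lemma exists_many_lattice_points {d : ℕ} {P : Set (Fin d → ℝ)} (hP0 : ∀ t ∈ P, ∀ j, 0 ≤ t j)
    (hconv : Convex ℝ P) (hint : (interior P).Nonempty) {t₀ : Fin d → ℝ} (ht₀ : t₀ ∈ P)
    {U : Set (Fin d → ℝ)} (hU : U ∈ 𝓝[P] t₀) :
    ∃ κ : ℝ, 0 < κ ∧ ∀ᶠ n : ℕ in atTop, ∃ G : Finset (Fin d → ℕ),
      (∀ α ∈ G, α ∈ latticeSet P n ∧ (fun j => (α j : ℝ) / n) ∈ U) ∧
      κ * (n : ℝ) ^ d ≤ G.card := by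
  obtain ⟨δ, hδ, hδU⟩ := Metric.mem_nhdsWithin_iff.1 hU
  -- The maximiser may lie on the boundary; convexity supplies interior points arbitrarily close to
  -- it.
  have hcl : t₀ ∈ closure (interior P) := by
    rw [hconv.closure_interior_eq_closure_of_nonempty_interior hint]
    exact subset_closure ht₀
  obtain ⟨u, huP, hu⟩ := Metric.mem_closure_iff.1 hcl δ hδ
  have hopen : IsOpen (interior P ∩ Metric.ball t₀ δ) := isOpen_interior.inter Metric.isOpen_ball
  obtain ⟨ρ, hρ, hρsub⟩ := Metric.nhds_basis_closedBall.mem_iff.1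
    (hopen.mem_nhds ⟨huP, by rwa [Metric.mem_ball, dist_comm]⟩)
  refine ⟨(ρ / 2) ^ d, by positivity, ?_⟩
  have hlarge : ∀ᶠ n : ℕ in atTop, 1 ≤ (n : ℝ) * ρ :=
    (tendsto_natCast_atTop_atTop.atTop_mul_const hρ).eventually_ge_atTop 1
  filter_upwards [hlarge, eventually_ge_atTop 1] with n hn hn1
  have hn0 : (0 : ℝ) < n := Nat.cast_pos.2 hn1
  have hu0 : ∀ j, 0 ≤ u j := hP0 u (interior_subset huP)
  -- A cube of `m ^ d` lattice points with lowest corner `⌈n u⌉`. As `k j ≤ m - 1`, the rounding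
  -- excess of the corner still fits within `n * ρ`.
  set m := ⌊(n : ℝ) * ρ⌋₊ with hm
  set e : (Fin d → ℕ) → (Fin d → ℕ) := fun k j => ⌈(n : ℝ) * u j⌉₊ + k j with he
  refine ⟨(Fintype.piFinset fun _ : Fin d => Finset.range m).image e, ?_, ?_⟩
  · intro α hα
    obtain ⟨k, hk, rfl⟩ := Finset.mem_image.1 hα
    have hmem : (fun j => (e k j : ℝ) / n) ∈ Metric.closedBall u ρ := by
      rw [Metric.mem_closedBall, dist_pi_le_iff hρ.le]
      intro j
      have hkj := Finset.mem_range.1 (Fintype.mem_piFinset.1 hk j)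
      have h1 : (k j : ℝ) + 1 ≤ n * ρ :=
        le_trans (by exact_mod_cast hkj) (Nat.floor_le (by positivity))
      have h2 := Nat.le_ceil ((n : ℝ) * u j)
      have h3 := Nat.ceil_lt_add_one (mul_nonneg hn0.le (hu0 j))
      have h4 : (0 : ℝ) ≤ k j := Nat.cast_nonneg _
      rw [Real.dist_eq, abs_le]
      simp only [he, Nat.cast_add]
      constructor
      · rw [neg_le_sub_iff_le_add, ← sub_le_iff_le_add, le_div_iff₀ hn0]
        nlinarith
      · rw [sub_le_iff_le_add, div_le_iff₀ hn0]
        nlinarith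
    obtain ⟨h1, h2⟩ := hρsub hmem
    exact ⟨(mem_latticeSet_iff (by omega)).2 (interior_subset h1),
      hδU ⟨h2, interior_subset h1⟩⟩
  · have hinj : Function.Injective e := fun k k' h => by
      ext j
      have := congrFun h j
      simp only [he] at this
      omega
    rw [Finset.card_image_of_injective _ hinj, Fintype.card_piFinset, Finset.prod_const,
      Finset.card_range, Finset.card_univ, Fintype.card_fin, ← mul_pow, Nat.cast_pow]
    -- From `m ≥ 1`, `n * ρ < m + 1 ≤ 2 * m`, whence the side `ρ / 2` in `κ`.
    have hm1 : (1 : ℝ) ≤ m := Nat.one_le_cast.2 (Nat.le_floor (by simpa using hn))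
    have := Nat.lt_floor_add_one ((n : ℝ) * ρ)
    gcongr
    linarith

/-- Two-sided exponential bounds for the monomials of the `P`-polynomial. -/
lemma eventually_coefficient_bounds {d : ℕ} {P : Set (Fin d → ℝ)} {f : (Fin d → ℝ) → ℝ}
    {c : (Fin d → ℕ) → ℕ → ℂ} (hc : HasExponentialProfile P f c)
    {z : Fin d → ℂ} (hz : ∀ j, z j ≠ 0) {ε : ℝ} (hε : 0 < ε) :
    ∀ᶠ n : ℕ in atTop, ∀ α ∈ latticeSet P n,
      Real.exp (n * (exponent f (logMap z) (fun j => (α j : ℝ) / n) - ε)) ≤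
          ‖c α n * ∏ j, z j ^ α j‖ ∧
        ‖c α n * ∏ j, z j ^ α j‖ ≤
          Real.exp (n * (exponent f (logMap z) (fun j => (α j : ℝ) / n) + ε)) := by
  have h := hc.eventually (gt_mem_nhds (ENNReal.ofReal_pos.2 hε))
  filter_upwards [h, eventually_ge_atTop 1] with n hn hn1 α hα
  have hn0 : (0 : ℝ) < n := Nat.cast_pos.2 hn1
  have h1 := (le_iSup₂ (f := fun α (_ : α ∈ latticeSet P n) =>
    (logAbs (c α n) / (n : EReal) -
        ((Real.log (f (fun j => (α j : ℝ) / (n : ℝ))) : ℝ) : EReal)).abs) α hα).trans_lt hn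
  set L := Real.log (f fun j => (α j : ℝ) / n)
  -- A vanishing coefficient would make the supremum infinite.
  have hc0 : c α n ≠ 0 := by
    intro h0
    rw [h0, logAbs] at h1
    simp only [enorm_zero, ENNReal.log_zero] at h1
    rw [EReal.bot_div_of_pos_ne_top (by exact_mod_cast hn1) (EReal.natCast_ne_top n)] at h1
    simp at h1
  rw [logAbs_of_ne_zero hc0] at h1
  have h2 : ((Real.log ‖c α n‖ : ℝ) : EReal) / (n : EReal) - (L : EReal) =
      ((Real.log ‖c α n‖ / n - L : ℝ) : EReal) := by
    push_cast
    rfl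
  rw [h2, EReal.abs_def, ENNReal.ofReal_lt_ofReal_iff hε, abs_lt] at h1
  have hcexp : ‖c α n‖ = Real.exp (n * (Real.log ‖c α n‖ / n)) := by
    rw [mul_div_cancel₀ _ hn0.ne', Real.exp_log (norm_pos_iff.2 hc0)]
  have hzexp : ‖∏ j, z j ^ α j‖ = Real.exp (n * ∑ j, logMap z j * ((α j : ℝ) / n)) := by
    rw [norm_prod, Finset.mul_sum, Real.exp_sum]
    refine Finset.prod_congr rfl fun j _ => ?_
    rw [norm_pow, logMap, show (n : ℝ) * (Real.log ‖z j‖ * ((α j : ℝ) / n)) =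
      (α j : ℝ) * Real.log ‖z j‖ by field_simp, Real.exp_nat_mul,
      Real.exp_log (norm_pos_iff.2 (hz j))]
  rw [norm_mul, hcexp, hzexp, ← Real.exp_add, ← mul_add, Real.exp_le_exp, Real.exp_le_exp,
    exponent]
  constructor <;> apply mul_le_mul_of_nonneg_left _ hn0.le <;> linarith [h1.1, h1.2]

lemma randomPoly_eq_sum {d : ℕ} {Ω : Type*} {P : Set (Fin d → ℝ)} (ξ : (Fin d → ℕ) → Ω → ℂ)
    (c : (Fin d → ℕ) → ℕ → ℂ) {n : ℕ} (h : (latticeSet P n).Finite) (z : Fin d → ℂ) (ω : Ω) :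
    randomPoly P ξ c n z ω = ∑ α ∈ h.toFinset, ξ α ω * (c α n * ∏ j, z j ^ α j) := by
  rw [randomPoly, finsum_mem_eq_finite_toFinset_sum _ h]
  simp only [mul_assoc]

/-! ### Deviation bounds and convergence in probability -/

section Potential

variable {d : ℕ} {Ω : Type*} [MeasurableSpace Ω] {μ : Measure Ω} [IsProbabilityMeasure μ]
  {ξ : (Fin d → ℕ) → Ω → ℂ} {P : Set (Fin d → ℝ)} {f : (Fin d → ℝ) → ℝ}
  {c : (Fin d → ℕ) → ℕ → ℂ} {z : Fin d → ℂ}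

/-- Polynomial bound for the probability that the random polynomial is exponentially smaller than
expected. -/
lemma exists_lower_deviation_bound (hmeas : ∀ α, Measurable (ξ α)) (hindep : iIndepFun ξ μ)
    (hident : ∀ α, IdentDistrib (ξ α) (ξ 0) μ μ)
    (hnondeg : ¬ ∃ a : ℂ, ∀ᵐ ω ∂μ, ξ 0 ω = a)
    (hP0 : ∀ t ∈ P, ∀ j, 0 ≤ t j) (hP : IsCompact P) (hconv : Convex ℝ P)
    (hint : (interior P).Nonempty) (hf : ContinuousOn f P) (hpos : ∀ t ∈ P, 0 < f t)
    (hc : HasExponentialProfile P f c) (hz : ∀ j, z j ≠ 0) {η : ℝ} (hη : 0 < η) :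
    ∃ C' : ℝ, 0 < C' ∧ ∀ n : ℕ, 1 ≤ n →
      μ.real {ω | ‖randomPoly P ξ c n z ω‖ ≤
          Real.exp ((n : ℝ) * (legendreTransform P f (logMap z) - 4 * η))} ≤
        C' * (n : ℝ) ^ (-((d : ℝ) / 2)) := by
  obtain ⟨t₀, ht₀, hI, -⟩ := exists_isGreatest_exponent hP (hint.mono interior_subset) hf hpos
    (logMap z)
  rw [hI]
  set I := exponent f (logMap z) t₀
  obtain ⟨r, hr, C, hC, hball⟩ := exists_small_ball_bound 0 hmeas hindep hident hnondeg
  have hU : {t | I - η < exponent f (logMap z) t} ∈ 𝓝[P] t₀ :=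
    (continuousOn_exponent hf hpos (logMap z) t₀ ht₀).eventually
      (lt_mem_nhds (by linarith))
  obtain ⟨κ, hκ, hmany⟩ := exists_many_lattice_points hP0 hconv hint ht₀ hU
  obtain ⟨K, hK⟩ := exists_card_latticeSet_le hP
  have hsmall : ∀ᶠ n : ℕ in atTop, Real.exp (-((n : ℝ) * (2 * η))) ≤ r :=
    (Real.tendsto_exp_neg_atTop_nhds_zero.comp
      (tendsto_natCast_atTop_atTop.atTop_mul_const (by positivity))).eventually
      (ge_mem_nhds hr)
  have hlarge : ∀ᶠ n : ℕ in atTop,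
      μ.real {ω | ‖randomPoly P ξ c n z ω‖ ≤ Real.exp ((n : ℝ) * (I - 4 * η))} ≤
        C / √κ * (n : ℝ) ^ (-((d : ℝ) / 2)) := by
    filter_upwards [hmany, hsmall, eventually_coefficient_bounds hc hz hη,
      eventually_ge_atTop 1] with n hn hnr hcoef hn1
    obtain ⟨G, hG, hGcard⟩ := hn
    obtain ⟨hfin, -⟩ := hK n hn1
    have hn0 : (0 : ℝ) < n := Nat.cast_pos.2 hn1
    have hκn : 0 < κ * (n : ℝ) ^ d := by positivity
    have hGne : G.Nonempty := by
      rw [← Finset.card_pos, ← Nat.cast_pos (α := ℝ)]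
      linarith
    -- Normalisation making the weights on `G` at least 1: one `η` pays for the variation of the
    -- exponent near `t₀`, one for the coefficient error. Of the `4η`, the other `2η` push the
    -- threshold down to `e^{-2nη} ≤ r`.
    set E : ℂ := ((Real.exp (-(n * (I - 2 * η))) : ℝ) : ℂ) with hE
    have hEnorm : ‖E‖ = Real.exp (-(n * (I - 2 * η))) := by
      rw [hE, Complex.norm_real, Real.norm_of_nonneg (Real.exp_pos _).le]
    have hb := hball hfin.toFinset G (fun α => E * (c α n * ∏ j, z j ^ α j))
      (fun α hα => by simpa using (hG α hα).1) hGne (fun α hα => by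
        obtain ⟨hα1, hα2⟩ := hG α hα
        rw [norm_mul, hEnorm]
        refine le_trans ?_ (mul_le_mul_of_nonneg_left (hcoef α hα1).1 (Real.exp_pos _).le)
        rw [← Real.exp_add, Real.one_le_exp_iff]
        have : 0 ≤ n * (exponent f (logMap z) (fun j => (α j : ℝ) / n) - (I - η)) :=
          mul_nonneg hn0.le (sub_nonneg.2 (le_of_lt hα2))
        linarith)
    have hpow : C / √(G.card : ℝ) ≤ C / √κ * (n : ℝ) ^ (-((d : ℝ) / 2)) := by
      have h1 : (n : ℝ) ^ (-((d : ℝ) / 2)) = (√((n : ℝ) ^ d))⁻¹ := by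
        rw [Real.rpow_neg hn0.le, Real.sqrt_eq_rpow, ← Real.rpow_natCast, ← Real.rpow_mul hn0.le]
        ring_nf
      rw [h1, ← div_eq_mul_inv, div_div, ← Real.sqrt_mul hκ.le]
      gcongr
    refine (measureReal_mono fun ω hω => ?_).trans (hb.trans hpow)
    simp only [Set.mem_ofPred_eq] at hω ⊢
    have hsum : ∑ α ∈ hfin.toFinset, ξ α ω * (E * (c α n * ∏ j, z j ^ α j)) =
        E * randomPoly P ξ c n z ω := by
      rw [randomPoly_eq_sum ξ c hfin, Finset.mul_sum]
      exact Finset.sum_congr rfl fun α _ => by ring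
    rw [hsum, norm_mul, hEnorm]
    refine (mul_le_mul_of_nonneg_left hω (Real.exp_pos _).le).trans (le_trans (le_of_eq ?_) hnr)
    rw [← Real.exp_add]
    congr 1
    ring
  obtain ⟨n₀, hn₀⟩ := eventually_atTop.1 hlarge
  -- The second summand covers `n ≤ n₀`, where the probability is only bounded by 1.
  refine ⟨C / √κ + (n₀ : ℝ) ^ ((d : ℝ) / 2), by positivity, fun n hn => ?_⟩
  have hn0 : (0 : ℝ) < n := Nat.cast_pos.2 hn
  rcases le_total n₀ n with h | h
  · refine (hn₀ n h).trans (mul_le_mul_of_nonneg_right ?_ (by positivity))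
    linarith [Real.rpow_nonneg (Nat.cast_nonneg (α := ℝ) n₀) ((d : ℝ) / 2)]
  · refine measureReal_le_one.trans ?_
    calc (1 : ℝ) = (n : ℝ) ^ ((d : ℝ) / 2) * (n : ℝ) ^ (-((d : ℝ) / 2)) := by
          rw [← Real.rpow_add hn0]; simp
      _ ≤ (n₀ : ℝ) ^ ((d : ℝ) / 2) * (n : ℝ) ^ (-((d : ℝ) / 2)) := by gcongr
      _ ≤ _ := by
          refine mul_le_mul_of_nonneg_right ?_ (by positivity)
          have : 0 < C / √κ := by positivity
          linarith

/-- The random polynomial is unlikely to be exponentially larger than expected. -/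
lemma tendsto_upper_deviation (hident : ∀ α, IdentDistrib (ξ α) (ξ 0) μ μ)
    (htail : (fun t : ℝ => μ.real {ω | t < Real.log (1 + ‖ξ 0 ω‖)})
      =o[atTop] (fun t : ℝ => t ^ (-(d : ℝ))))
    (hP : IsCompact P) (hne : P.Nonempty) (hf : ContinuousOn f P) (hpos : ∀ t ∈ P, 0 < f t)
    (hc : HasExponentialProfile P f c) (hz : ∀ j, z j ≠ 0) {ε : ℝ} (hε : 0 < ε) :
    Tendsto (fun n : ℕ => μ.real {ω |
      Real.exp ((n : ℝ) * (legendreTransform P f (logMap z) + 3 * ε)) < ‖randomPoly P ξ c n z ω‖})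
      atTop (𝓝 0) := by
  obtain ⟨t₀, ht₀, hI, hmax⟩ := exists_isGreatest_exponent hP hne hf hpos (logMap z)
  rw [hI]
  set I := exponent f (logMap z) t₀
  obtain ⟨K, hK⟩ := exists_card_latticeSet_le hP
  have hscale : Tendsto (fun n : ℕ => (n : ℝ) * ε) atTop atTop :=
    tendsto_natCast_atTop_atTop.atTop_mul_const hε
  -- The tail hypothesis at `t = n * ε` beats exactly the `O(n^d)` terms of the union bound.
  have hunion : Tendsto (fun n : ℕ => ((K * n : ℕ) : ℝ) ^ d *
      μ.real {ω | n * ε < Real.log (1 + ‖ξ 0 ω‖)}) atTop (𝓝 0) := by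
    have h1 := ((htail.comp_tendsto hscale).tendsto_div_nhds_zero).const_mul (((K : ℝ) / ε) ^ d)
    rw [mul_zero] at h1
    refine h1.congr' ?_
    filter_upwards [eventually_ge_atTop 1] with n hn
    have hn0 : (0 : ℝ) < n := Nat.cast_pos.2 hn
    simp only [Function.comp_apply]
    rw [Real.rpow_neg (by positivity), Real.rpow_natCast, div_inv_eq_mul, mul_comm (μ.real _),
      ← mul_assoc, ← mul_pow]
    congr 2
    push_cast
    field_simp
  have hcount : ∀ᶠ n : ℕ in atTop, ((K * n : ℕ) : ℝ) ^ d ≤ Real.exp (n * ε) := by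
    have h1 := ((Real.tendsto_pow_mul_exp_neg_atTop_nhds_zero d).comp hscale).const_mul
      (((K : ℝ) / ε) ^ d)
    rw [mul_zero] at h1
    filter_upwards [h1.eventually (ge_mem_nhds zero_lt_one)] with n hn
    simp only [Function.comp_apply] at hn
    rw [← mul_assoc, ← mul_pow, Real.exp_neg, ← div_eq_mul_inv, div_le_one (Real.exp_pos _)] at hn
    refine le_trans (le_of_eq ?_) hn
    push_cast
    congr 1
    field_simp
  refine squeeze_zero' (Eventually.of_forall fun n => measureReal_nonneg) ?_ hunion
  filter_upwards [hcount, eventually_coefficient_bounds hc hz hε, eventually_ge_atTop 1]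
    with n hcnt hcoef hn1
  obtain ⟨hfin, hcard⟩ := hK n hn1
  have hn0 : (0 : ℝ) < n := Nat.cast_pos.2 hn1
  have hcard' : (hfin.toFinset.card : ℝ) ≤ ((K * n : ℕ) : ℝ) ^ d := by exact_mod_cast hcard
  have htailα : ∀ α, μ.real {ω | n * ε < Real.log (1 + ‖ξ α ω‖)} =
      μ.real {ω | n * ε < Real.log (1 + ‖ξ 0 ω‖)} := fun α => by
    have hm : MeasurableSet {x : ℂ | n * ε < Real.log (1 + ‖x‖)} :=
      measurableSet_lt measurable_const (by fun_prop)
    exact congrArg ENNReal.toReal ((hident α).measure_mem_eq hm)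
  -- The three `ε` pay for the size of the `ξ α`, the coefficient error and the number of terms.
  have hsub : {ω | Real.exp ((n : ℝ) * (I + 3 * ε)) < ‖randomPoly P ξ c n z ω‖} ⊆
      ⋃ α ∈ hfin.toFinset, {ω | n * ε < Real.log (1 + ‖ξ α ω‖)} := by
    intro ω hω
    by_contra hnot
    simp only [Set.mem_iUnion, Set.mem_ofPred_eq, not_exists, not_lt] at hnot
    rw [Set.mem_ofPred_eq] at hω
    refine absurd hω (not_lt.2 ?_)
    rw [randomPoly_eq_sum ξ c hfin]
    calc ‖∑ α ∈ hfin.toFinset, ξ α ω * (c α n * ∏ j, z j ^ α j)‖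
        ≤ ∑ α ∈ hfin.toFinset, Real.exp (n * ε) * Real.exp (n * (I + ε)) := by
          refine norm_sum_le_of_le _ fun α hα => ?_
          rw [norm_mul]
          have hα' : α ∈ latticeSet P n := by simpa using hα
          have h1 : ‖ξ α ω‖ ≤ Real.exp (n * ε) := by
            have := (Real.log_le_iff_le_exp (by positivity)).1 (hnot α hα)
            linarith
          have h2 := hmax _ ((mem_latticeSet_iff (by omega)).1 hα')
          refine mul_le_mul h1 ((hcoef α hα').2.trans ?_) (norm_nonneg _) (Real.exp_pos _).le
          gcongr
      _ = hfin.toFinset.card * (Real.exp (n * ε) * Real.exp (n * (I + ε))) := by simp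
      _ ≤ Real.exp (n * ε) * (Real.exp (n * ε) * Real.exp (n * (I + ε))) := by
          gcongr
          exact hcard'.trans hcnt
      _ = Real.exp ((n : ℝ) * (I + 3 * ε)) := by
          rw [← Real.exp_add, ← Real.exp_add]
          congr 1
          ring
  calc _ ≤ μ.real (⋃ α ∈ hfin.toFinset, {ω | n * ε < Real.log (1 + ‖ξ α ω‖)}) :=
        measureReal_mono hsub (measure_ne_top _ _)
    _ ≤ ∑ α ∈ hfin.toFinset, μ.real {ω | n * ε < Real.log (1 + ‖ξ α ω‖)} :=
        measureReal_biUnion_finset_le _ _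
    _ = hfin.toFinset.card * μ.real {ω | n * ε < Real.log (1 + ‖ξ 0 ω‖)} := by simp [htailα]
    _ ≤ _ := by gcongr

/-- Convergence in probability of the normalized potential from the two deviation bounds. -/
lemma tendstoInProbability_logPotential {I : ℝ}
    (hlow : ∀ ε : ℝ, 0 < ε → Tendsto (fun n : ℕ => μ.real {ω |
      ‖randomPoly P ξ c n z ω‖ ≤ Real.exp ((n : ℝ) * (I - ε))}) atTop (𝓝 0))
    (hup : ∀ ε : ℝ, 0 < ε → Tendsto (fun n : ℕ => μ.real {ω |
      Real.exp ((n : ℝ) * (I + ε)) < ‖randomPoly P ξ c n z ω‖}) atTop (𝓝 0))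
    (hmeas : ∀ n, Measurable (randomPoly P ξ c n z)) :
    TendstoInProbability μ (fun n ω => logPotential P ξ c n z ω) ((I : ℝ) : EReal) := by
  intro O hO hmem
  obtain ⟨ε, hε, hball⟩ := Metric.mem_nhds_iff.1
    ((continuous_coe_real_ereal.tendsto I) (hO.mem_nhds hmem))
  have hsum := (hlow (ε / 2) (by positivity)).add (hup (ε / 2) (by positivity))
  rw [add_zero] at hsum
  have hlim : Tendsto (fun n : ℕ => ENNReal.ofReal (1 -
      (μ.real {ω | ‖randomPoly P ξ c n z ω‖ ≤ Real.exp ((n : ℝ) * (I - ε / 2))} +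
        μ.real {ω | Real.exp ((n : ℝ) * (I + ε / 2)) < ‖randomPoly P ξ c n z ω‖})))
      atTop (𝓝 1) := by
    simpa using ENNReal.tendsto_ofReal (hsum.const_sub 1)
  refine tendsto_of_tendsto_of_tendsto_of_le_of_le' hlim tendsto_const_nhds ?_
    (Eventually.of_forall fun n => prob_le_one)
  filter_upwards [eventually_ge_atTop 1] with n hn
  have hn0 : (0 : ℝ) < n := Nat.cast_pos.2 hn
  set L := {ω | ‖randomPoly P ξ c n z ω‖ ≤ Real.exp ((n : ℝ) * (I - ε / 2))}
  set V := {ω | Real.exp ((n : ℝ) * (I + ε / 2)) < ‖randomPoly P ξ c n z ω‖}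
  have hLV : MeasurableSet (L ∪ V) :=
    (measurableSet_le (hmeas n).norm measurable_const).union
      (measurableSet_lt measurable_const (hmeas n).norm)
  have hsub : (L ∪ V)ᶜ ⊆ {ω | logPotential P ξ c n z ω ∈ O} := by
    intro ω hω
    simp only [Set.mem_compl_iff, Set.mem_union, not_or, L, V, Set.mem_ofPred_eq, not_le,
      not_lt] at hω
    obtain ⟨hω1, hω2⟩ := hω
    -- Off the two bad events the value at `z` is nonzero, so the convention for identically
    -- vanishing polynomials plays no role.
    have hpos : 0 < ‖randomPoly P ξ c n z ω‖ := (Real.exp_pos _).trans hω1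
    have hne := norm_pos_iff.1 hpos
    rw [Set.mem_ofPred_eq, logPotential, if_neg fun h => hne (h z), logAbs_of_ne_zero hne]
    have h2 : ((Real.log ‖randomPoly P ξ c n z ω‖ : ℝ) : EReal) / (n : EReal) =
        ((Real.log ‖randomPoly P ξ c n z ω‖ / n : ℝ) : EReal) := rfl
    rw [h2]
    refine hball ?_
    rw [Metric.mem_ball, Real.dist_eq]
    have h3 := (Real.lt_log_iff_exp_lt hpos).2 hω1
    have h4 := (Real.log_le_iff_le_exp hpos).2 hω2
    refine lt_of_le_of_lt ?_ (half_lt_self hε)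
    rw [abs_le, neg_le_sub_iff_le_add, ← sub_le_iff_le_add, le_div_iff₀ hn0, sub_le_iff_le_add,
      div_le_iff₀ hn0]
    constructor <;> linarith
  refine le_trans ?_ (measure_mono hsub)
  rw [← ofReal_measureReal, probReal_compl_eq_one_sub hLV]
  exact ENNReal.ofReal_le_ofReal (sub_le_sub_left (measureReal_union_le _ _) _)

end Potential

end RandomPPolynomial

/-! ### Assembly of the theorem -/

open RandomPPolynomial in
theorem theorem3p3 {d : ℕ} (hd : 1 ≤ d)
    {Ω : Type*} [MeasurableSpace Ω] (μ : Measure Ω) [IsProbabilityMeasure μ]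
    (ξ : (Fin d → ℕ) → Ω → ℂ)
    (hξ_meas : ∀ α, Measurable (ξ α))
    (hξ_indep : iIndepFun ξ μ)
    (hξ_ident : ∀ α, IdentDistrib (ξ α) (ξ 0) μ μ)
    (hξ_nondeg : ¬ ∃ a : ℂ, ∀ᵐ ω ∂μ, ξ 0 ω = a)
    (hξ_tail : (fun t : ℝ => μ.real {ω | t < Real.log (1 + ‖ξ 0 ω‖)})
      =o[atTop] (fun t : ℝ => t ^ (-(d : ℝ))))
    (P : Set (Fin d → ℝ)) (hP_orthant : ∀ t ∈ P, ∀ j, 0 ≤ t j)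
    (hP_compact : IsCompact P) (hP_convex : Convex ℝ P) (hP_int : (interior P).Nonempty)
    (hP_zero : (0 : Fin d → ℝ) ∈ P)
    (f : (Fin d → ℝ) → ℝ) (hf_cont : ContinuousOn f P) (hf_pos : ∀ t ∈ P, 0 < f t)
    (c : (Fin d → ℕ) → ℕ → ℂ) (hc : HasExponentialProfile P f c)
    (z : Fin d → ℂ) (hz : ∀ j, z j ≠ 0) :
    TendstoInProbability μ (fun n ω => logPotential P ξ c n z ω)
        ((torusPotential P f z : ℝ) : EReal) ∧
      ∀ η : ℝ, 0 < η → ∃ C' : ℝ, 0 < C' ∧ ∀ n : ℕ, 1 ≤ n →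
        μ.real {ω | ‖randomPoly P ξ c n z ω‖ ≤
            Real.exp ((n : ℝ) * (legendreTransform P f (logMap z) - 4 * η))} ≤
          C' * (n : ℝ) ^ (-((d : ℝ) / 2)) := by
  have hPne : P.Nonempty := ⟨0, hP_zero⟩
  have hlow : ∀ η : ℝ, 0 < η → _ := fun η hη =>
    exists_lower_deviation_bound hξ_meas hξ_indep hξ_ident hξ_nondeg hP_orthant hP_compact
      hP_convex hP_int hf_cont hf_pos hc hz hη
  refine ⟨tendstoInProbability_logPotential (fun ε hε => ?_) (fun ε hε => ?_) (fun n => ?_), hlow⟩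
  · obtain ⟨C, -, hC⟩ := hlow (ε / 4) (by positivity)
    have hd2 : (0 : ℝ) < (d : ℝ) / 2 := by
      have : (0 : ℝ) < d := Nat.cast_pos.2 hd
      positivity
    have hlim := ((tendsto_rpow_neg_atTop hd2).comp tendsto_natCast_atTop_atTop).const_mul C
    rw [mul_zero] at hlim
    refine squeeze_zero' (Eventually.of_forall fun n => measureReal_nonneg) ?_ hlim
    filter_upwards [eventually_ge_atTop 1] with n hn
    rw [show ε = 4 * (ε / 4) by ring]
    exact hC n hn
  · have h := tendsto_upper_deviation hξ_ident hξ_tail hP_compact hPne hf_cont hf_pos hc hz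
      (ε := ε / 3) (by positivity)
    rwa [show 3 * (ε / 3) = ε by ring] at h
  · have hfin : (latticeSet P n).Finite := by
      rcases Nat.eq_zero_or_pos n with rfl | hn
      -- For `n = 0` the dilate `0 • P` contains at most the origin, so the rescaling by `1/n` is
      -- not needed.
      · refine (Set.finite_singleton 0).subset fun α hα => ?_
        obtain ⟨t, -, ht⟩ := hα
        ext j
        simpa [eq_comm] using congrFun ht j
      · exact ((exists_card_latticeSet_le hP_compact).choose_spec n hn).choose
    rw [show randomPoly P ξ c n z = fun ω => _ from funext fun ω =>
      randomPoly_eq_sum ξ c hfin z ω]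
    exact Finset.measurable_sum _ fun α _ => (hξ_meas α).mul_const _
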